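/- Let $\mathcal{L}$ be a first-order language with no relation symbols and with at least one constant symbol; an algebra is an $\mathcal{L}$-structure. An equation is an atomic formula $s\approx t$, and a literal is an equation or a negated equation. Conjunctions are finite, and the empty conjunction is $\top$. For a conjunction of literals $\psi$, let $\psi^+$ be the conjunction of the equations occurring positively in $\psi$. For a class $\mathcal{K}$ of algebras, $\mathcal{K}\models\alpha$ means that $\alpha$ holds in every member of $\mathcal{K}$ under every assignment, and $\mathrm{Th}(\mathcal{K})$ is the set of first-order sentences true in all members of $\mathcal{K}$. $\mathcal{K}$ is a universal class if it is the class of all models of some set of universal sentences. A theory $T^*$ is a model completion of a theory $T$ if $T$ and $T^*$ entail the same universal sentences, every formula is equivalent over $T^*$ to an existential formula, and for every model $M$ of $T$ the theory $T^*$ together with the diagram of $M$ (the atomic and negated atomic sentences true in $M$, in the language with a constant added for each element of $M$) is complete. $\mathcal{K}$ has * the amalgamation property if for all $\mathbf{A},\mathbf{B},\mathbf{C}\in\mathcal{K}$ and embeddings $f\colon\mathbf{A}\to\mathbf{B}$, $g\colon\mathbf{A}\to\mathbf{C}$ there are $\mathbf{D}\in\mathcal{K}$ and embeddings $h\colon\mathbf{B}\to\mathbf{D}$,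 $k\colon\mathbf{C}\to\mathbf{D}$ with $hf=kg$; * the variable projection property if for any finite set of variables $\overline{x},y$ and conjunction of equations $\varphi(\overline{x},y)$ there is a quantifier-free formula $\xi(\overline{x})$ such that $\mathcal{K}\models\varphi\to\xi$ and, for every equation $\varepsilon(\overline{x})$, $\mathcal{K}\models\varphi\to\varepsilon$ implies $\mathcal{K}\models\xi\to\varepsilon$; * the conservative model extension property if for any finite set of variables $\overline{x},y$ and conjunction of literals $\psi(\overline{x},y)$ there is a quantifier-free formula $\chi(\overline{x})$ such that (i) $\mathcal{K}\models\psi\to\chi$, and (ii) whenever $\mathbf{A}\in\mathcal{K}$ is generated by a tuple $\overline{a}$, $\mathbf{A}\models\chi(\overline{a})$, and $\mathbf{A}\models\varepsilon(\overline{a})$ for every equation $\varepsilon(\overline{x})$ with $\mathcal{K}\models\psi^+\to\varepsilon$, there are $\mathbf{B}\in\mathcal{K}$ extending $\mathbf{A}$ and $b\in B$ with $\mathbf{B}\models\psi(\overline{a},b)$. **Theorem.** Let $\mathcal{K}$ be a universal class of algebras. Then $\mathrm{Th}(\mathcal{K})$ has a model completion if and only if $\mathcal{K}$ has the amalgamation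 property, the variable projection property, and the conservative model extension property. -/

import Mathlib

open FirstOrder

universe u v w

namespace FirstOrder.Language

variable {L : Language.{u, v}}

section Syntactic

variable {α : Type*}

/-- The atomic formula `s ≈ t` given by a pair `(s, t)` of terms: an equation. -/
def eqnFormula (e : L.Term α × L.Term α) : L.Formula α :=
  e.1.equal e.2

/-- The conjunction of a finite list of formulas; the empty conjunction is `⊤`. -/
def conj (l : List (L.Formula α)) : L.Formula α :=
  l.foldr (fun φ ψ => φ ⊓ ψ) ⊤

/-- The conjunction of a finite list of equations. -/
def conjEqns (l : List (L.Term α × L.Term α)) : L.Formula α :=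
  conj (l.map eqnFormula)

variable (L α) in
/-- A literal of an algebraic language: an equation or a negated equation. -/
inductive Literal : Type _
  | pos (e : L.Term α × L.Term α) : Literal
  | neg (e : L.Term α × L.Term α) : Literal

/-- The formula expressed by a literal. -/
def Literal.toFormula : Literal L α → L.Formula α
  | .pos e => eqnFormula e
  | .neg e => (eqnFormula e).not

/-- The equation of a positive literal; nothing for a negative one. -/
def Literal.posPart : Literal L α → Option (L.Term α × L.Term α)
  | .pos e => some e
  | .neg _ => none

/-- The conjunction of a finite list of literals. -/
def conjLiterals (l : List (Literal L α)) : L.Formula α :=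
  conj (l.map Literal.toFormula)

/-- The conjunction `ψ⁺` of the equations that occur positively in a conjunction `ψ` of
literals. -/
def conjPos (l : List (Literal L α)) : L.Formula α :=
  conjEqns (l.filterMap Literal.posPart)

end Syntactic

section Classes

/-- `K ⊨ φ`: the formula `φ` holds in all members of `K` under all assignments. -/
def ClassModels {α : Type*} (K : Set (CategoryTheory.Bundled.{w} L.Structure))
    (φ : L.Formula α) : Prop :=
  ∀ A ∈ K, ∀ a : α → A, φ.Realize a

/-- The first-order theory `Th(K)` of a class `K` of structures. -/
def classTheory (K : Set (CategoryTheory.Bundled.{w} L.Structure)) : L.Theory :=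
  {φ | ∀ A ∈ K, A ⊨ φ}

/-- A universal class: the class of all models of a set of universal sentences. -/
def IsUniversalClass (K : Set (CategoryTheory.Bundled.{w} L.Structure)) : Prop :=
  ∃ U : L.Theory, U.IsUniversal ∧
    ∀ A : CategoryTheory.Bundled.{w} L.Structure, A ∈ K ↔ A ⊨ U

/-- The variable projection property. The variables `x̄` are indexed by `Fin n`, and `y` is the
extra variable in `Fin n ⊕ Unit`; a formula `ξ(x̄)` is regarded as a formula in `x̄, y` by
relabelling along `Sum.inl`. -/
def VariableProjectionProperty (K : Set (CategoryTheory.Bundled.{w} L.Structure)) : Prop :=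
  ∀ (n : ℕ) (φ : List (L.Term (Fin n ⊕ Unit) × L.Term (Fin n ⊕ Unit))),
    ∃ ξ : L.Formula (Fin n), BoundedFormula.IsQF ξ ∧
      ClassModels K ((conjEqns φ).imp (ξ.relabel Sum.inl)) ∧
      ∀ ε : L.Term (Fin n) × L.Term (Fin n),
        ClassModels K ((conjEqns φ).imp ((eqnFormula ε).relabel Sum.inl)) →
        ClassModels K (ξ.imp (eqnFormula ε))

/-- The conservative model extension property, with the same convention on variables. That `A`
is generated by `ā` means that the substructure generated by its entries is all of `A`, and an
extension `B` of `A` is given by an embedding of `A` into `B`. -/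
def ConservativeModelExtensionProperty
    (K : Set (CategoryTheory.Bundled.{w} L.Structure)) : Prop :=
  ∀ (n : ℕ) (ψ : List (Literal L (Fin n ⊕ Unit))),
    ∃ χ : L.Formula (Fin n), BoundedFormula.IsQF χ ∧
      ClassModels K ((conjLiterals ψ).imp (χ.relabel Sum.inl)) ∧
      ∀ A ∈ K, ∀ a : Fin n → A,
        Substructure.closure L (Set.range a) = ⊤ →
        χ.Realize a →
        (∀ ε : L.Term (Fin n) × L.Term (Fin n),
          ClassModels K ((conjPos ψ).imp ((eqnFormula ε).relabel Sum.inl)) →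
          (eqnFormula ε).Realize a) →
        ∃ B ∈ K, ∃ (f : A ↪[L] B) (b : B),
          (conjLiterals ψ).Realize (Sum.elim (f ∘ a) (fun _ => b))

end Classes

namespace Theory

/-- Two theories are co-theories if they entail the same universal sentences. -/
def IsCoTheory (T T' : L.Theory) : Prop :=
  ∀ φ : L.Sentence, BoundedFormula.IsUniversal φ → (T ⊨ᵇ φ ↔ T' ⊨ᵇ φ)

/-- A theory is model complete if every formula is equivalent over it to an existential
formula (in the same free variables). -/
def IsModelComplete (T : L.Theory) : Prop :=
  ∀ (n : ℕ) (φ : L.Formula (Fin n)),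
    ∃ ψ : L.Formula (Fin n), BoundedFormula.IsExistential ψ ∧ T ⊨ᵇ φ.iff ψ

/-- `T'` is a model companion of `T` if it is a model complete co-theory of `T`. -/
def IsModelCompanion (T' T : L.Theory) : Prop :=
  T'.IsModelComplete ∧ T.IsCoTheory T'

end Theory

variable (L) in
/-- The diagram of a structure `M`: the atomic and negated atomic sentences, in the language
expanded by a constant for each element of `M`, that are true in `M`. -/
def diagram (M : Type w) [L.Structure M] : L[[M]].Theory :=
  {φ | (BoundedFormula.IsAtomic φ ∨ ∃ ψ : L[[M]].Sentence, BoundedFormula.IsAtomic ψ ∧ φ = ψ.not)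
    ∧ M ⊨ φ}

/-- `T'` is a model completion of `T` if it is a model companion of `T` and, for every model
`M` of `T`, the theory `T'` together with the diagram of `M` is complete. -/
def Theory.IsModelCompletion (T' T : L.Theory) : Prop :=
  T'.IsModelCompanion T ∧
    ∀ (M : Type (max u v w)) [L.Structure M] [Nonempty M], M ⊨ T →
      ((L.lhomWithConstants M).onTheory T' ∪ L.diagram M).IsComplete

end FirstOrder.Language

/-! Suppose T* is a model completion of Th(K). Completeness of T* with the diagram of A ∈ K means
that a formula with parameters in A has the same truth value in all models of T* extending A
(`realize_iff`). Tuples with the same quantifier-free type generate isomorphic algebras, which lie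
in K because K is universal; hence, by compactness, T* eliminates quantifiers (`exists_isQF_iff`).
The quantifier-free equivalents of ∃y φ and ∃y ψ serve as ξ and χ. For amalgamation, finitely many
facts about C over A transfer to a model extending B, and compactness combines them.

Conversely, χ ∧ ξ defines, in members of K, the tuples that can be extended to a solution of ψ in
some extension in K (`exists_definesExtendability`): ξ supplies the equations that conservative
model extension asks of the generated subalgebra, and amalgamation carries the resulting extension
over to the whole algebra. The axioms (χ ∧ ξ) ↔ ∃y ψ eliminate quantifiers, and a chain construction
embeds every member of K into a member satisfying them. Completeness over a diagram follows, since a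
quantifier-free formula with parameters in A is already decided in A. -/

namespace FirstOrder.Language

variable {L : Language.{u, v}}

/-! ### Compactness and a criterion for quantifier-free definability -/

section Compactness

universe w₁ w₂ w₃ w₄

/-- The compactness theorem for families of formulas in arbitrarily many variables. -/
theorem Theory.exists_realize_forall_of_finset {T : L.Theory} {α : Type w₁} {ι : Type w₄}
    (Φ : ι → L.Formula α)
    (h : ∀ s : Finset ι, ∃ (M : T.ModelType.{u, v, w₂}) (a : α → M),
      ∀ i ∈ s, (Φ i).Realize a) :
    ∃ (M : T.ModelType.{u, v, max u v w₁ w₃}) (a : α → M), ∀ i, (Φ i).Realize a := by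
  classical
  let T' : Option ι → L[[α]].Theory := fun o =>
    o.elim ((L.lhomWithConstants α).onTheory T) fun i => {Formula.equivSentence (Φ i)}
  have hsat : Theory.IsSatisfiable (⋃ o, T' o) := by
    rw [Theory.isSatisfiable_iUnion_iff_isSatisfiable_iUnion_finset]
    intro s
    obtain ⟨M, a, ha⟩ := h (Finset.eraseNone s)
    let : (constantsOn α).Structure M := constantsOn.structure a
    have : M ⊨ ⋃ o ∈ s, T' o := by
      rw [Theory.model_iff]
      intro φ hφ
      simp only [Set.mem_iUnion] at hφ
      obtain ⟨o, ho, hφ⟩ := hφ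
      cases o with
      | none =>
        have hM : M ⊨ (L.lhomWithConstants α).onTheory T :=
          (LHom.onTheory_model _ _).2 inferInstance
        exact (Theory.model_iff _).1 hM φ hφ
      | some i =>
        obtain rfl : φ = Formula.equivSentence (Φ i) := hφ
        exact (Formula.realize_equivSentence M (Φ i)).2 (ha i (Finset.mem_eraseNone.2 ho))
    exact Theory.Model.isSatisfiable M
  obtain ⟨N⟩ := hsat
  -- The lift only moves the model into the prescribed universe.
  let N' := Theory.ModelType.ulift.{_, _, _, max u v w₁ w₃} N
  have hN : ∀ o, ∀ φ ∈ T' o, (N' : Type _) ⊨ φ := fun o φ hφ =>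
    Theory.realize_sentence_of_mem _ (Set.mem_iUnion.2 ⟨o, hφ⟩)
  let := (L.lhomWithConstants α).reduct N'
  have hT : N' ⊨ T := (LHom.onTheory_model (L.lhomWithConstants α) T).1
    ((Theory.model_iff _).2 (hN none))
  exact ⟨⟨N'⟩, fun x => (L.con x : N'), fun i =>
    (Formula.realize_equivSentence N' (Φ i)).1 (hN (some i) _ rfl)⟩

theorem BoundedFormula.isQF_iInf {α : Type w₁} {n : ℕ} {ι : Type*} [Finite ι]
    {Φ : ι → L.BoundedFormula α n} (h : ∀ i, (Φ i).IsQF) : (BoundedFormula.iInf Φ).IsQF := by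
  have hl : ∀ l : List ι, ((l.map Φ).foldr (· ⊓ ·) ⊤).IsQF := fun l => by
    induction l with
    | nil => exact IsQF.top
    | cons i l ih => exact (h i).inf ih
  exact hl _

/-- A formula preserved between tuples that satisfy the same quantifier-free formulas is equivalent
to a quantifier-free formula. -/
theorem Theory.exists_isQF_iff_of_preserved {T : L.Theory} {α : Type w₁} (φ : L.Formula α)
    (h : ∀ (M N : T.ModelType.{u, v, max u v w₁ w₃}) (a : α → M) (b : α → N),
      (∀ θ : L.Formula α, BoundedFormula.IsQF θ → (θ.Realize a ↔ θ.Realize b)) →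
        φ.Realize a → φ.Realize b) :
    ∃ θ : L.Formula α, BoundedFormula.IsQF θ ∧
      ∀ (M : T.ModelType.{u, v, max u v w₁ w₃}) (a : α → M), φ.Realize a ↔ θ.Realize a := by
  let Γ := {θ : L.Formula α // BoundedFormula.IsQF θ ∧
    ∀ (M : T.ModelType.{u, v, max u v w₁ w₃}) (a : α → M), φ.Realize a → θ.Realize a}
  -- The quantifier-free type of `b` is consistent with `φ`: otherwise the negation of a finite part
  -- of it would lie in `Γ` and hold at `b`.
  have key : ∀ (N : T.ModelType.{u, v, max u v w₁ w₃}) (b : α → N),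
      (∀ θ : Γ, θ.1.Realize b) → φ.Realize b := by
    intro N b hb
    let ι := {θ : L.Formula α // BoundedFormula.IsQF θ ∧ θ.Realize b}
    obtain ⟨M, a, ha⟩ := exists_realize_forall_of_finset.{u, v, w₁, max u v w₁ w₃, w₃} (T := T)
      (fun o : Option ι => o.elim φ fun i => i.1) (by
        intro s
        by_contra hs
        let t := Finset.eraseNone s
        let θ : L.Formula α := Formula.iInf fun i : t => i.1.1
        have hθ : BoundedFormula.IsQF θ := BoundedFormula.isQF_iInf fun i => i.1.2.1
        have hΓ := hb ⟨θ.not, hθ.not, fun M a hφ hθa => hs ⟨M, a, fun o ho => by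
          cases o with
          | none => exact hφ
          | some i =>
            exact Formula.realize_iInf.1 hθa ⟨i, Finset.mem_eraseNone.2 ho⟩⟩⟩
        exact hΓ (Formula.realize_iInf.2 fun i => i.1.2.2))
    refine h M N a b (fun θ hθ => ⟨fun hθa => ?_, fun hθb => ha (some ⟨θ, hθ, hθb⟩)⟩) (ha none)
    by_contra hθb
    exact ha (some ⟨θ.not, hθ.not, hθb⟩) hθa
  -- If no finite part of `Γ` implied `φ`, then `Γ` together with `¬φ` would be realized, against
  -- `key`.
  by_contra hcon
  obtain ⟨M, a, ha⟩ := exists_realize_forall_of_finset.{u, v, w₁, max u v w₁ w₃, w₃} (T := T)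
    (fun o : Option Γ => o.elim φ.not fun i => i.1) (by
      intro s
      by_contra hs
      let t := Finset.eraseNone s
      refine hcon ⟨Formula.iInf fun i : t => i.1.1, BoundedFormula.isQF_iInf fun i => i.1.2.1,
        fun M a => ⟨fun hφ => Formula.realize_iInf.2 fun i => i.1.2.2 M a hφ, fun hθ => ?_⟩⟩
      by_contra hφ
      refine hs ⟨M, a, fun o ho => ?_⟩
      cases o with
      | none => exact hφ
      | some i => exact Formula.realize_iInf.1 hθ ⟨i, Finset.mem_eraseNone.2 ho⟩)
  exact ha none (key M a fun θ => ha (some θ))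

end Compactness

/-! ### Embeddings of algebras and generating tuples -/

section Embeddings

variable {M : Type*} {N : Type*} [L.Structure M] [L.Structure N]

theorem BoundedFormula.isQF_equal {α : Type*} (s t : L.Term α) :
    BoundedFormula.IsQF (s.equal t) :=
  (IsAtomic.equal _ _).isQF

theorem BoundedFormula.IsQF.realize_comp_embedding {α : Type*} {φ : L.Formula α}
    (hφ : BoundedFormula.IsQF φ) (f : M ↪[L] N) {a : α → M} :
    φ.Realize (f ∘ a) ↔ φ.Realize a := by
  have := hφ.realize_embedding f (v := a) (xs := default)
  rwa [Subsingleton.elim (f ∘ default) default] at this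

theorem exists_term_of_closure_range_eq_top {α : Type*} {a : α → M}
    (ha : Substructure.closure L (Set.range a) = ⊤) (x : M) : ∃ t : L.Term α, t.realize a = x := by
  have hx : x ∈ Substructure.closure L (Set.range a) := ha ▸ Substructure.mem_top x
  obtain ⟨t, rfl⟩ := Substructure.mem_closure_iff_exists_term.1 hx
  choose k hk using fun y : Set.range a => y.2
  refine ⟨t.relabel k, ?_⟩
  rw [Term.realize_relabel]
  congr 1
  exact funext hk

/-- The coordinates of a tuple, as elements of the substructure generated by it. -/
def closureTuple {α : Type*} (a : α → M) (i : α) : Substructure.closure L (Set.range a) :=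
  ⟨a i, Substructure.subset_closure (Set.mem_range_self i)⟩

theorem closure_range_closureTuple {α : Type*} (a : α → M) :
    Substructure.closure L (Set.range (closureTuple (L := L) a)) = ⊤ := by
  apply Substructure.map_injective_of_injective
    (f := (Substructure.closure L (Set.range a)).subtype.toHom) Subtype.val_injective
  rw [Substructure.map_closure, ← Set.range_comp]
  exact (Hom.range_eq_map _).symm.trans (Substructure.range_subtype _) |>.symm

variable [L.IsAlgebraic]

/-- A map that preserves equations and their negations is an embedding. -/
theorem exists_embedding_of_equal (g : M → N)
    (h : ∀ s t : L.Term M, s.realize id = t.realize id ↔ s.realize g = t.realize g) :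
    ∃ f : M ↪[L] N, ⇑f = g := by
  have hinj : Function.Injective g := fun x y hxy => (h (.var x) (.var y)).2 hxy
  let f : M →[L] N :=
    { toFun := g
      map_fun' := fun {n} F x =>
        (h (.var (Structure.funMap F x)) (.func F fun i => .var (x i))).1 rfl
      map_rel' := fun {n} r => (IsEmpty.false r).elim }
  exact ⟨Embedding.ofInjective (f := f) hinj, rfl⟩

theorem exists_embedding_of_qf (g : M → N)
    (h : ∀ φ : L.Formula M, BoundedFormula.IsQF φ → φ.Realize id → φ.Realize g) :
    ∃ f : M ↪[L] N, ⇑f = g := by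
  refine exists_embedding_of_equal g fun s t => ⟨fun hst => ?_, fun hst => ?_⟩
  · exact Formula.realize_equal.1
      (h (s.equal t) (BoundedFormula.isQF_equal s t) (Formula.realize_equal.2 hst))
  · by_contra hne
    exact h (s.equal t).not (BoundedFormula.isQF_equal s t).not
      (fun hst' => hne (Formula.realize_equal.1 hst')) (Formula.realize_equal.2 hst)

/-- Tuples satisfying the same equations generate isomorphic structures. -/
theorem exists_embedding_of_closure_range_eq_top {α : Type*} {a : α → M} {b : α → N}
    (ha : Substructure.closure L (Set.range a) = ⊤)
    (h : ∀ s t : L.Term α, s.realize a = t.realize a ↔ s.realize b = t.realize b) :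
    ∃ f : M ↪[L] N, f ∘ a = b := by
  -- Each element is named by a term in the generators; the embedding evaluates that term at `b`.
  choose k hk using exists_term_of_closure_range_eq_top ha
  have hsub : ∀ (s : L.Term M), (s.subst k).realize a = s.realize id := fun s => by
    rw [Term.realize_subst]
    congr 1
    exact funext hk
  obtain ⟨f, hf⟩ := exists_embedding_of_equal (fun x => (k x).realize b) fun s t => by
    rw [← hsub, ← hsub, h, Term.realize_subst, Term.realize_subst]
  refine ⟨f, funext fun i => ?_⟩
  rw [hf]
  exact (h (k (a i)) (.var i)).1 (hk _)

end Embeddings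

/-- Every formula depends on finitely many variables only. -/
theorem Formula.exists_fin_relabel {α : Type*} (φ : L.Formula α) :
    ∃ (n : ℕ) (g : Fin n → α) (φ' : L.Formula (Fin n)),
      ∀ (M : Type*) [L.Structure M] (a : α → M), φ.Realize a ↔ φ'.Realize (a ∘ g) := by
  classical
  let e := Finset.equivFin φ.freeVarFinset
  exact ⟨_, fun i => (e.symm i).1, BoundedFormula.restrictFreeVar φ e, fun M _ a =>
    (BoundedFormula.realize_restrictFreeVar a (by simp)).symm⟩

/-! ### Models of the diagram as extensions -/

section Diagram

variable {M : Type w} [L.Structure M]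

theorem BoundedFormula.IsAtomic.equivSentence_symm {α : Type*} {φ : L[[α]].Sentence}
    (hφ : BoundedFormula.IsAtomic φ) :
    BoundedFormula.IsAtomic (Formula.equivSentence.symm φ : L.Formula α) := by
  cases hφ with
  | equal s t => exact IsAtomic.equal _ _
  | rel R ts => exact IsAtomic.rel _ _

/-- Interpreting the constants by an embedding gives a model of the diagram. -/
theorem Embedding.model_diagram {N : Type*} [L.Structure N] (f : M ↪[L] N) :
    letI : (constantsOn M).Structure N := constantsOn.structure f
    N ⊨ L.diagram M := by
  let : (constantsOn M).Structure N := constantsOn.structure f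
  have key : ∀ φ : L[[M]].Sentence, BoundedFormula.IsAtomic φ → (M ⊨ φ ↔ N ⊨ φ) := fun φ hφ => by
    rw [← Formula.realize_equivSentence_symm_con M, ← Formula.realize_equivSentence_symm_con N]
    exact (hφ.equivSentence_symm.isQF.realize_comp_embedding f).symm
  refine (Theory.model_iff _).2 fun φ hφ => ?_
  obtain ⟨hφ | ⟨ψ, hψ, rfl⟩, hM⟩ := hφ
  · exact (key φ hφ).1 hM
  · exact fun h => hM ((key ψ hψ).2 h)

variable [L.IsAlgebraic]

/-- A model of the diagram of `M` is an extension of `M`. -/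
theorem exists_embedding_of_model_diagram {N : Type*} [L.Structure N] [L[[M]].Structure N]
    [(L.lhomWithConstants M).IsExpansionOn N] (hN : N ⊨ L.diagram M) :
    ∃ f : M ↪[L] N, ∀ x, f x = (L.con x : N) := by
  obtain ⟨f, hf⟩ := exists_embedding_of_equal (M := M) (fun x => (L.con x : N)) fun s t => by
    let φ : L[[M]].Sentence := Formula.equivSentence (s.equal t)
    have hφ : BoundedFormula.IsAtomic φ := BoundedFormula.IsAtomic.equal _ _
    have h1 : M ⊨ φ ↔ s.realize id = t.realize id :=
      (Formula.realize_equivSentence M _).trans Formula.realize_equal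
    have h2 : N ⊨ φ ↔ s.realize (fun x => (L.con x : N)) = t.realize (fun x => (L.con x : N)) :=
      (Formula.realize_equivSentence N _).trans Formula.realize_equal
    rw [← h1, ← h2]
    refine ⟨fun h => (Theory.model_iff _).1 hN φ ⟨Or.inl hφ, h⟩, fun h => ?_⟩
    by_contra hM
    exact (Theory.model_iff _).1 hN φ.not ⟨Or.inr ⟨φ, hφ, rfl⟩, hM⟩ h
  exact ⟨f, fun x => congrFun hf x⟩

end Diagram

/-! ### Consequences of a model completion: quantifier elimination and amalgamation -/

section Classes

variable {K : Set (CategoryTheory.Bundled.{max u v w} L.Structure)}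

theorem IsUniversalClass.mem_iff (hK : IsUniversalClass K)
    (A : CategoryTheory.Bundled.{max u v w} L.Structure) : A ∈ K ↔ A ⊨ classTheory K := by
  obtain ⟨U, -, hU⟩ := hK
  refine ⟨fun h => (Theory.model_iff _).2 fun φ hφ => hφ A h, fun h => (hU A).2 ?_⟩
  exact (Theory.model_iff _).2 fun φ hφ =>
    (Theory.model_iff _).1 h φ fun B hB => (Theory.model_iff _).1 ((hU B).1 hB) φ hφ

theorem IsUniversalClass.mem_of_embedding (hK : IsUniversalClass K)
    {A B : CategoryTheory.Bundled.{max u v w} L.Structure} (hB : B ∈ K) (f : A ↪[L] B) :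
    A ∈ K := by
  obtain ⟨U, hU', hU⟩ := hK
  have : B ⊨ U := (hU B).1 hB
  exact (hU A).2 (Theory.IsUniversal.models_of_embedding f)

namespace Theory.IsModelCompletion

variable {T : L.Theory}

/-- The universal axioms of `K` follow from `classTheory K`, hence from its co-theory `T`. -/
theorem mem (hT : IsModelCompletion.{u, v, w} T (classTheory K)) (hK : IsUniversalClass K)
    (N : T.ModelType.{u, v, max u v w}) : CategoryTheory.Bundled.of (c := L.Structure) N ∈ K := by
  obtain ⟨U, hU', hU⟩ := hK
  refine (hU _).2 ((Theory.model_iff _).2 fun φ hφ => ?_)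
  have h1 : classTheory K ⊨ᵇ φ :=
    models_sentence_of_mem fun B hB => (Theory.model_iff _).1 ((hU B).1 hB) φ hφ
  exact ((hT.1.2 φ (hU'.isUniversal_of_mem hφ)).1 h1).realize_sentence N

variable [Nonempty L.Constants]

/-- Naming the elements of `A` through `f` and `g` makes `M` and `N` models of the same complete
theory. -/
theorem realize_iff (hT : IsModelCompletion.{u, v, w} T (classTheory K))
    (hK : IsUniversalClass K) {A : CategoryTheory.Bundled.{max u v w} L.Structure} (hA : A ∈ K)
    {M N : T.ModelType.{u, v, max u v w}} (f : A ↪[L] M) (g : A ↪[L] N) (φ : L.Formula A) :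
    φ.Realize f ↔ φ.Realize g := by
  have : Nonempty A := nonempty_of_nonempty_constants L A
  have hc := hT.2 A ((hK.mem_iff A).1 hA)
  have key : ∀ {N : T.ModelType.{u, v, max u v w}} (f : A ↪[L] N),
      φ.Realize f ↔ (L.lhomWithConstants A).onTheory T ∪ L.diagram A ⊨ᵇ
        Formula.equivSentence φ := fun {N} f => by
    let : (constantsOn A).Structure N := constantsOn.structure f
    have h1 : N ⊨ (L.lhomWithConstants A).onTheory T := (LHom.onTheory_model _ _).2 inferInstance
    have h2 : N ⊨ L.diagram A := f.model_diagram
    have := h1.union h2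
    rw [← hc.realize_sentence_iff _ N, Formula.realize_equivSentence]
    rfl
  rw [key f, key g]

/-- A quantifier-free formula with parameters from `C` that holds in `C` holds in every model of
the model completion extending `A`, under an assignment fixing the parameters from `A`. -/
theorem exists_realize_of_realize (hT : IsModelCompletion.{u, v, w} T (classTheory K))
    (hK : IsUniversalClass K) {A C : CategoryTheory.Bundled.{max u v w} L.Structure}
    (hA : A ∈ K) (g : A ↪[L] C) {M N : T.ModelType.{u, v, max u v w}} (f : A ↪[L] M)
    (j : C ↪[L] N) (φ : L.Formula C) (hφ : φ.Realize j) :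
    ∃ h : C → M, h ∘ g = f ∧ φ.Realize h := by
  classical
  let S := φ.freeVarFinset
  -- Variables in the image of `g` become parameters from `A`; the others are quantified
  -- existentially.
  let r : S → A ⊕ S := fun c => if h : ∃ x, g x = c then Sum.inl h.choose else Sum.inr c
  let φ' : L.Formula A := Formula.iExs S (BoundedFormula.restrictFreeVar φ r)
  have hN : φ'.Realize (j.comp g) := by
    refine Formula.realize_iExs.2 ⟨fun c => j c, ?_⟩
    refine (BoundedFormula.realize_restrictFreeVar (⇑j) fun c => ?_).2 hφ
    by_cases h : ∃ x, g x = c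
    · simp only [r, dif_pos h, Sum.elim_inl, Embedding.comp_apply, h.choose_spec]
    · simp only [r, dif_neg h, Sum.elim_inr]
  have hM : φ'.Realize f := (hT.realize_iff hK hA f (j.comp g) φ').2 hN
  obtain ⟨b, hb⟩ := Formula.realize_iExs.1 hM
  -- Outside the image of `g` and the variables of `φ` the value does not matter.
  let h : C → M := fun c =>
    if h : ∃ x, g x = c then f h.choose else if h : c ∈ S then b ⟨c, h⟩ else Classical.arbitrary M
  refine ⟨h, funext fun x => ?_, (BoundedFormula.realize_restrictFreeVar h fun c => ?_).1 hb⟩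
  · have hx : ∃ y, g y = g x := ⟨x, rfl⟩
    simp only [h, Function.comp_apply, dif_pos hx]
    rw [g.injective hx.choose_spec]
  · by_cases hc : ∃ x, g x = c
    · simp only [r, h, dif_pos hc, Sum.elim_inl]
    · have hS : c.1 ∈ S := c.2
      simp only [r, h, dif_neg hc, Sum.elim_inr, dif_pos hS]
      rfl

variable [L.IsAlgebraic]

/-- A complete theory is satisfiable, so `T` with the diagram of `A` has a model. -/
theorem exists_embedding (hT : IsModelCompletion.{u, v, w} T (classTheory K))
    (hK : IsUniversalClass K) {A : CategoryTheory.Bundled.{max u v w} L.Structure} (hA : A ∈ K) :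
    ∃ N : T.ModelType.{u, v, max u v w}, Nonempty (A ↪[L] N) := by
  have : Nonempty A := nonempty_of_nonempty_constants L A
  obtain ⟨⟨N⟩, -⟩ := hT.2 A ((hK.mem_iff A).1 hA)
  have hN := N.is_model
  rw [Theory.model_union_iff] at hN
  let := (L.lhomWithConstants A).reduct N
  have hNT : N ⊨ T := (LHom.onTheory_model (L.lhomWithConstants A) T).1 hN.1
  obtain ⟨f, -⟩ := exists_embedding_of_model_diagram (M := A) (N := N) hN.2
  exact ⟨⟨N⟩, ⟨f⟩⟩

/-- The model completion of the theory of a universal class eliminates quantifiers. -/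
theorem exists_isQF_iff (hT : IsModelCompletion.{u, v, w} T (classTheory K))
    (hK : IsUniversalClass K) {n : ℕ} (φ : L.Formula (Fin n)) :
    ∃ θ : L.Formula (Fin n), BoundedFormula.IsQF θ ∧
      ∀ (M : T.ModelType.{u, v, max u v w}) (a : Fin n → M), φ.Realize a ↔ θ.Realize a := by
  refine exists_isQF_iff_of_preserved.{u, v, 0, w} φ fun M N a b hab hφ => ?_
  -- `A` is determined up to isomorphism by the equations true of `a`, so both `M` and `N` extend
  -- it, with `a` corresponding to `b`.
  let A := Substructure.closure L (Set.range a)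
  have hA : CategoryTheory.Bundled.of (c := L.Structure) A ∈ K :=
    hK.mem_of_embedding (hT.mem hK M) A.subtype
  obtain ⟨g, hg⟩ := exists_embedding_of_closure_range_eq_top (N := N) (b := b)
    (closure_range_closureTuple a) fun s t => by
      have := hab (s.equal t) (BoundedFormula.isQF_equal s t)
      rw [Formula.realize_equal, Formula.realize_equal] at this
      rw [← this]
      have hr : ∀ r : L.Term (Fin n), r.realize a = (r.realize (closureTuple a) : A) := fun r =>
        HomClass.realize_term A.subtype (v := closureTuple a)
      rw [hr, hr, Subtype.val_inj]
  have := hT.realize_iff hK hA A.subtype g (φ.relabel (closureTuple a))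
  have h2 := (Formula.realize_relabel (v := A.subtype)).symm.trans
    (this.trans (Formula.realize_relabel (v := g)))
  rw [hg] at h2
  exact h2.1 hφ

theorem classModels_iff (hT : IsModelCompletion.{u, v, w} T (classTheory K))
    (hK : IsUniversalClass K) {α : Type*} {φ : L.Formula α} (hφ : BoundedFormula.IsQF φ) :
    ClassModels K φ ↔ ∀ (M : T.ModelType.{u, v, max u v w}) (a : α → M), φ.Realize a := by
  refine ⟨fun h M => h _ (hT.mem hK M), fun h A hA a => ?_⟩
  obtain ⟨N, ⟨f⟩⟩ := hT.exists_embedding hK hA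
  exact (hφ.realize_comp_embedding f).1 (h N (f ∘ a))

theorem amalgamation (hT : IsModelCompletion.{u, v, w} T (classTheory K))
    (hK : IsUniversalClass K) : Amalgamation K := by
  classical
  intro A B C f g hA hB hC
  obtain ⟨M, ⟨i⟩⟩ := hT.exists_embedding hK hB
  obtain ⟨N, ⟨j⟩⟩ := hT.exists_embedding hK hC
  let D (X : CategoryTheory.Bundled.{max u v w} L.Structure) :=
    {φ : L.Formula X // BoundedFormula.IsQF φ ∧ φ.Realize id}
  -- The quantifier-free facts of `B` and of `C`, and equations identifying the two images of `A`.
  let Φ : D B ⊕ D C ⊕ A → L.Formula (B ⊕ C) :=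
    Sum.elim (fun φ => φ.1.relabel Sum.inl)
      (Sum.elim (fun φ => φ.1.relabel Sum.inr)
        fun x => Term.equal (.var (.inl (f x))) (.var (.inr (g x))))
  obtain ⟨Q, a, ha⟩ := Theory.exists_realize_forall_of_finset.{u, v, max u v w, max u v w, w}
    (T := T) Φ (by
      intro s
      -- `M` already satisfies all facts about `B`; only the finitely many selected facts about `C`
      -- must be transferred to it.
      let t : Finset (D C) := s.toRight.toLeft
      let ψ : L.Formula C := Formula.iInf fun φ : t => φ.1.1
      have hψ : ψ.Realize j := Formula.realize_iInf.2 fun φ =>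
        (φ.1.2.1.realize_comp_embedding j (a := id)).2 φ.1.2.2
      obtain ⟨h, hg, hh⟩ := hT.exists_realize_of_realize hK hA g (i.comp f) j ψ hψ
      refine ⟨M, Sum.elim i h, ?_⟩
      rintro (φ | φ | x) hs
      · exact Formula.realize_relabel.2 ((φ.2.1.realize_comp_embedding i (a := id)).2 φ.2.2)
      · exact Formula.realize_relabel.2
          (Formula.realize_iInf.1 hh ⟨φ, Finset.mem_toLeft.2 (Finset.mem_toRight.2 hs)⟩)
      · exact Formula.realize_equal.2 (congrFun hg x).symm)
  obtain ⟨i', hi⟩ := exists_embedding_of_qf (a ∘ Sum.inl) fun φ h1 h2 =>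
    Formula.realize_relabel.1 (ha (.inl ⟨φ, h1, h2⟩))
  obtain ⟨j', hj⟩ := exists_embedding_of_qf (a ∘ Sum.inr) fun φ h1 h2 =>
    Formula.realize_relabel.1 (ha (.inr (.inl ⟨φ, h1, h2⟩)))
  refine ⟨CategoryTheory.Bundled.of Q, i', j', hT.mem hK Q, Embedding.ext fun x => ?_⟩
  exact (congrFun hi (f x)).trans
    ((Formula.realize_equal.1 (ha (.inr (.inr x)))).trans (congrFun hj (g x)).symm)

end Theory.IsModelCompletion

end Classes

/-! ### Finite conjunctions and a single existential quantifier -/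

section Conjunctions

variable {α : Type*}

theorem realize_conj {M : Type*} [L.Structure M] {l : List (L.Formula α)} {a : α → M} :
    (conj l).Realize a ↔ ∀ φ ∈ l, φ.Realize a :=
  BoundedFormula.realize_foldr_inf l a default

theorem isQF_conj {l : List (L.Formula α)} (h : ∀ φ ∈ l, BoundedFormula.IsQF φ) :
    BoundedFormula.IsQF (conj l) := by
  induction l with
  | nil => exact BoundedFormula.IsQF.top
  | cons φ l ih =>
    exact (h φ List.mem_cons_self).inf (ih fun ψ hψ => h ψ (List.mem_cons_of_mem _ hψ))

theorem isQF_conjEqns (l : List (L.Term α × L.Term α)) : BoundedFormula.IsQF (conjEqns l) :=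
  isQF_conj fun φ hφ => by
    obtain ⟨e, -, rfl⟩ := List.mem_map.1 hφ
    exact BoundedFormula.isQF_equal _ _

theorem Literal.isQF_toFormula : ∀ l : Literal L α, BoundedFormula.IsQF l.toFormula
  | .pos _ => BoundedFormula.isQF_equal _ _
  | .neg _ => (BoundedFormula.isQF_equal _ _).not

theorem isQF_conjLiterals (l : List (Literal L α)) : BoundedFormula.IsQF (conjLiterals l) :=
  isQF_conj fun φ hφ => by
    obtain ⟨e, -, rfl⟩ := List.mem_map.1 hφ
    exact e.isQF_toFormula

theorem BoundedFormula.IsQF.formula_relabel {β : Type*} {φ : L.Formula α}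
    (hφ : BoundedFormula.IsQF φ) (g : α → β) : BoundedFormula.IsQF (φ.relabel g) :=
  hφ.relabel _

theorem Formula.realize_iExs_unit {M : Type*} [L.Structure M] {φ : L.Formula (α ⊕ Unit)}
    {a : α → M} : (φ.iExs Unit).Realize a ↔ ∃ b : M, φ.Realize (Sum.elim a fun _ => b) :=
  Formula.realize_iExs.trans ⟨fun ⟨b, hb⟩ => ⟨b (), hb⟩, fun ⟨b, hb⟩ => ⟨fun _ => b, hb⟩⟩

theorem Formula.realize_iExs_of_realize {M : Type*} [L.Structure M] {φ : L.Formula (α ⊕ Unit)}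
    {a : α ⊕ Unit → M} (h : φ.Realize a) : (φ.iExs Unit).Realize (a ∘ Sum.inl) :=
  Formula.realize_iExs.2 ⟨a ∘ Sum.inr, by rwa [Sum.elim_comp_inl_inr]⟩

theorem realize_relabel_inl_elim {M : Type*} [L.Structure M] {φ : L.Formula α}
    {a : α → M} {b : M} :
    (φ.relabel (Sum.inl : α → α ⊕ Unit)).Realize (Sum.elim a fun _ => b) ↔ φ.Realize a := by
  rw [Formula.realize_relabel, Sum.elim_comp_inl]

end Conjunctions

/-! ### Variable projection and conservative model extension from quantifier elimination -/

namespace Theory.IsModelCompletion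

variable {K : Set (CategoryTheory.Bundled.{max u v w} L.Structure)} {T : L.Theory}
  [L.IsAlgebraic] [Nonempty L.Constants]

/-- As y does not occur in `ξ`, the implication for all y says that ∃y `φ` implies `ξ`;
quantifier-free validity in `K` can be tested in models of `T`. -/
theorem classModels_imp_relabel (hT : IsModelCompletion.{u, v, w} T (classTheory K))
    (hK : IsUniversalClass K) {n : ℕ} {φ : L.Formula (Fin n ⊕ Unit)}
    (hφ : BoundedFormula.IsQF φ) {ξ : L.Formula (Fin n)} (hξ : BoundedFormula.IsQF ξ) :
    ClassModels K (φ.imp (ξ.relabel Sum.inl)) ↔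
      ∀ (M : T.ModelType.{u, v, max u v w}) (a : Fin n → M),
        (φ.iExs Unit).Realize a → ξ.Realize a := by
  rw [hT.classModels_iff hK (hφ.imp (hξ.formula_relabel _))]
  refine forall_congr' fun M => ⟨fun h a ha => ?_, fun h a => ?_⟩
  · obtain ⟨b, hb⟩ := Formula.realize_iExs_unit.1 ha
    exact realize_relabel_inl_elim.1 ((Formula.realize_imp (φ := φ)).1 (h _) hb)
  · exact Formula.realize_imp.2 fun ha =>
      Formula.realize_relabel.2 (h _ (Formula.realize_iExs_of_realize ha))

theorem variableProjectionProperty (hT : IsModelCompletion.{u, v, w} T (classTheory K))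
    (hK : IsUniversalClass K) : VariableProjectionProperty K := by
  intro n φ
  obtain ⟨ξ, hξ, h⟩ := hT.exists_isQF_iff hK ((conjEqns φ).iExs Unit)
  refine ⟨ξ, hξ, ?_, fun ε hε => ?_⟩
  · exact (hT.classModels_imp_relabel hK (isQF_conjEqns φ) hξ).2 fun M a => (h M a).1
  · have hεQF : BoundedFormula.IsQF (eqnFormula ε) := BoundedFormula.isQF_equal _ _
    rw [hT.classModels_imp_relabel hK (isQF_conjEqns φ) hεQF] at hε
    rw [hT.classModels_iff hK (hξ.imp hεQF)]
    exact fun M a => Formula.realize_imp.2 fun ha => hε M a ((h M a).2 ha)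

theorem conservativeModelExtensionProperty
    (hT : IsModelCompletion.{u, v, w} T (classTheory K)) (hK : IsUniversalClass K) :
    ConservativeModelExtensionProperty K := by
  intro n ψ
  obtain ⟨χ, hχ, h⟩ := hT.exists_isQF_iff hK ((conjLiterals ψ).iExs Unit)
  refine ⟨χ, hχ, ?_, fun A hA a _ ha _ => ?_⟩
  · exact (hT.classModels_imp_relabel hK (isQF_conjLiterals ψ) hχ).2 fun M a => (h M a).1
  -- A model of `T` above `A` serves as the extension: there `χ` is equivalent to ∃y `ψ`.
  · obtain ⟨N, ⟨f⟩⟩ := hT.exists_embedding hK hA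
    obtain ⟨b, hb⟩ := Formula.realize_iExs_unit.1
      ((h N (f ∘ a)).2 ((hχ.realize_comp_embedding f).2 ha))
    exact ⟨_, hT.mem hK N, f, b, hb⟩

end Theory.IsModelCompletion

/-! ### Quantifier elimination from axioms for ∃y ψ -/

section Elimination

theorem BoundedFormula.isQF_iSup {α : Type*} {n : ℕ} {ι : Type*} [Finite ι]
    {Φ : ι → L.BoundedFormula α n} (h : ∀ i, (Φ i).IsQF) : (BoundedFormula.iSup Φ).IsQF := by
  have hl : ∀ l : List ι, ((l.map Φ).foldr (· ⊔ ·) ⊥).IsQF := fun l => by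
    induction l with
    | nil => exact isQF_bot
    | cons i l ih => exact (h i).sup ih
  exact hl _

theorem realize_conjLiterals {α : Type*} {M : Type*} [L.Structure M] {l : List (Literal L α)}
    {a : α → M} : (conjLiterals l).Realize a ↔ ∀ e ∈ l, e.toFormula.Realize a := by
  simp only [conjLiterals, realize_conj, List.forall_mem_map]

/-- Disjunctive normal form of a quantifier-free formula. -/
theorem BoundedFormula.IsQF.exists_dnf [L.IsAlgebraic] {α : Type*} {φ : L.Formula α}
    (hφ : BoundedFormula.IsQF φ) :
    ∃ D : List (List (Literal L α)), ∀ (M : Type w) [L.Structure M] (a : α → M),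
      φ.Realize a ↔ ∃ l ∈ D, (conjLiterals l).Realize a := by
  -- A normal form of the negation is carried along, because an implication negates its premise.
  suffices h : ∃ D E : List (List (Literal L α)), ∀ (M : Type w) [L.Structure M] (a : α → M),
      (φ.Realize a ↔ ∃ l ∈ D, (conjLiterals l).Realize a) ∧
      (¬ φ.Realize a ↔ ∃ l ∈ E, (conjLiterals l).Realize a) by
    obtain ⟨D, _, h⟩ := h
    exact ⟨D, fun M _ a => (h M a).1⟩
  induction hφ with
  | falsum =>
    refine ⟨[], [ [] ], fun M _ a => ⟨?_, ?_⟩⟩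
    · simp [Formula.Realize, BoundedFormula.Realize]
    · have h0 : ¬ Formula.Realize (BoundedFormula.falsum : L.Formula α) a := fun h => h
      simp [h0, realize_conjLiterals]
  | of_isAtomic h =>
    cases h with
    | equal s t =>
      let e : L.Term α × L.Term α :=
        (s.relabel (Sum.elim id Fin.elim0), t.relabel (Sum.elim id Fin.elim0))
      have he : ∀ (M : Type w) [L.Structure M] (a : α → M),
          Formula.Realize (s.bdEqual t) a ↔ (eqnFormula e).Realize a := fun M _ a => by
        have h0 : Sum.elim a default = a ∘ (Sum.elim id Fin.elim0 : α ⊕ Fin 0 → α) := by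
          funext x
          rcases x with i | i
          · rfl
          · exact i.elim0
        rw [eqnFormula, Formula.realize_equal, Term.realize_relabel, Term.realize_relabel,
          Formula.Realize, BoundedFormula.realize_bdEqual, h0]
      refine ⟨[ [.pos e] ], [ [.neg e] ], fun M _ a => ?_⟩
      rw [he]
      simp [realize_conjLiterals, Literal.toFormula]
    | rel R ts => exact (IsEmpty.false R).elim
  | imp _ _ ih₁ ih₂ =>
    obtain ⟨D₁, E₁, h₁⟩ := ih₁
    obtain ⟨D₂, E₂, h₂⟩ := ih₂
    refine ⟨E₁ ++ D₂, D₁.flatMap fun l => E₂.map fun m => l ++ m, fun M _ a => ⟨?_, ?_⟩⟩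
    · simp only [List.mem_append, or_and_right, exists_or]
      rw [← (h₁ M a).2, ← (h₂ M a).1, ← imp_iff_not_or]
      exact Formula.realize_imp
    · rw [Formula.realize_imp, Classical.not_imp, (h₁ M a).1, (h₂ M a).2]
      simp only [List.mem_flatMap, List.mem_map]
      constructor
      · rintro ⟨⟨l, hl, hla⟩, m, hm, hma⟩
        refine ⟨_, ⟨l, hl, m, hm, rfl⟩, realize_conjLiterals.2 fun e he => ?_⟩
        exact (List.mem_append.1 he).elim (realize_conjLiterals.1 hla e)
          (realize_conjLiterals.1 hma e)
      · rintro ⟨_, ⟨l, hl, m, hm, rfl⟩, h⟩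
        rw [realize_conjLiterals] at h
        exact ⟨⟨l, hl, realize_conjLiterals.2 fun e he => h e (List.mem_append_left _ he)⟩,
          m, hm, realize_conjLiterals.2 fun e he => h e (List.mem_append_right _ he)⟩

/-- The theory expressing that each `τ n ψ` is equivalent to `∃ y, ψ`. -/
def eliminationTheory (τ : ∀ n : ℕ, List (Literal L (Fin n ⊕ Unit)) → L.Formula (Fin n)) :
    L.Theory :=
  {σ | ∃ (n : ℕ) (ψ : List (Literal L (Fin n ⊕ Unit))),
    σ = Formula.iAlls (Fin n)
      (((τ n ψ).iff ((conjLiterals ψ).iExs Unit)).relabel (Sum.inr : Fin n → Empty ⊕ Fin n))}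

variable {τ : ∀ n : ℕ, List (Literal L (Fin n ⊕ Unit)) → L.Formula (Fin n)}

theorem model_eliminationTheory_iff {M : Type*} [L.Structure M] :
    M ⊨ eliminationTheory τ ↔
      ∀ (n : ℕ) (ψ : List (Literal L (Fin n ⊕ Unit))) (a : Fin n → M),
        (τ n ψ).Realize a ↔ ∃ b : M, (conjLiterals ψ).Realize (Sum.elim a fun _ => b) := by
  have key : ∀ (n : ℕ) (ψ : List (Literal L (Fin n ⊕ Unit))),
      M ⊨ (Formula.iAlls (Fin n) (((τ n ψ).iff ((conjLiterals ψ).iExs Unit)).relabel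
        (Sum.inr : Fin n → Empty ⊕ Fin n)) : L.Sentence) ↔
      ∀ a : Fin n → M, (τ n ψ).Realize a ↔
        ∃ b : M, (conjLiterals ψ).Realize (Sum.elim a fun _ => b) := fun n ψ => by
    refine Formula.realize_iAlls.trans (forall_congr' fun a => ?_)
    rw [Formula.realize_relabel, Formula.realize_iff]
    exact iff_congr Iff.rfl Formula.realize_iExs_unit
  rw [Theory.model_iff]
  constructor
  · exact fun h n ψ => (key n ψ).1 (h _ ⟨n, ψ, rfl⟩)
  · rintro h _ ⟨n, ψ, rfl⟩
    exact (key n ψ).2 (h n ψ)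

variable [L.IsAlgebraic]

/-- Elimination of a single existential quantifier. -/
theorem exists_isQF_iff_exists (hτ : ∀ n ψ, BoundedFormula.IsQF (τ n ψ)) {n : ℕ}
    {φ : L.Formula (Fin n ⊕ Unit)} (hφ : BoundedFormula.IsQF φ) :
    ∃ θ : L.Formula (Fin n), BoundedFormula.IsQF θ ∧
      ∀ (M : Type w) [L.Structure M], M ⊨ eliminationTheory τ → ∀ a : Fin n → M,
        (∃ b : M, φ.Realize (Sum.elim a fun _ => b)) ↔ θ.Realize a := by
  obtain ⟨D, hD⟩ := BoundedFormula.IsQF.exists_dnf.{u, v, w} hφ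
  -- The existential quantifier distributes over the disjuncts of the normal form.
  refine ⟨Formula.iSup fun i : Fin D.length => τ n (D.get i),
    BoundedFormula.isQF_iSup fun i => hτ _ _, fun M _ hM a => ?_⟩
  rw [model_eliminationTheory_iff] at hM
  simp only [Formula.realize_iSup, hM, hD]
  constructor
  · rintro ⟨b, l, hl, hb⟩
    obtain ⟨i, rfl⟩ := List.mem_iff_get.1 hl
    exact ⟨i, b, hb⟩
  · rintro ⟨i, b, hb⟩
    exact ⟨b, _, List.get_mem D i, hb⟩

theorem exists_isQF_iff_bounded (hτ : ∀ n ψ, BoundedFormula.IsQF (τ n ψ)) {n : ℕ}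
    (φ : L.BoundedFormula Empty n) :
    ∃ θ : L.Formula (Fin n), BoundedFormula.IsQF θ ∧
      ∀ (M : Type w) [L.Structure M], M ⊨ eliminationTheory τ → ∀ a : Fin n → M,
        φ.Realize default a ↔ θ.Realize a := by
  induction φ with
  | falsum => exact ⟨⊥, BoundedFormula.isQF_bot, fun M _ _ a => Iff.rfl⟩
  | @equal n s t =>
    let r : Empty ⊕ Fin n → Fin n := Sum.elim Empty.elim id
    refine ⟨(s.relabel r).equal (t.relabel r), BoundedFormula.isQF_equal _ _,
      fun M _ _ a => ?_⟩
    have h0 : Sum.elim default a = a ∘ r := by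
      funext x
      rcases x with i | i
      · exact i.elim
      · rfl
    rw [Formula.realize_equal, Term.realize_relabel, Term.realize_relabel, ← h0]
    rfl
  | rel R ts => exact (IsEmpty.false R).elim
  | imp _ _ ih₁ ih₂ =>
    obtain ⟨θ₁, hθ₁, h₁⟩ := ih₁
    obtain ⟨θ₂, hθ₂, h₂⟩ := ih₂
    refine ⟨θ₁.imp θ₂, hθ₁.imp hθ₂, fun M _ hM a => ?_⟩
    rw [BoundedFormula.realize_imp, Formula.realize_imp, h₁ M hM a, h₂ M hM a]
  | @all n φ ih =>
    obtain ⟨θ, hθ, h⟩ := ih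
    -- The last variable, the one bound by ∀, becomes y; then ∀ is treated as ¬∃¬.
    let r : Fin (n + 1) → Fin n ⊕ Unit := Fin.snoc (α := fun _ => Fin n ⊕ Unit) Sum.inl (Sum.inr ())
    obtain ⟨ξ, hξ, h'⟩ := exists_isQF_iff_exists.{u, v, w} hτ (hθ.not.formula_relabel r)
    refine ⟨ξ.not, hξ.not, fun M _ hM a => ?_⟩
    rw [Formula.realize_not, ← h' M hM a, BoundedFormula.realize_all, not_exists]
    refine forall_congr' fun b => ?_
    have h0 : (Fin.snoc a b : Fin (n + 1) → M) = Sum.elim a (fun _ => b) ∘ r :=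
      (Fin.comp_snoc (α := Fin n ⊕ Unit) (β := M) (Sum.elim a fun _ => b) Sum.inl (Sum.inr ())).symm
    rw [Formula.realize_relabel, ← h0, Formula.realize_not, not_not, h M hM]

/-- Quantifier elimination for `eliminationTheory τ`. -/
theorem exists_isQF_iff_of_model_eliminationTheory (hτ : ∀ n ψ, BoundedFormula.IsQF (τ n ψ))
    {α : Type*} (φ : L.Formula α) :
    ∃ θ : L.Formula α, BoundedFormula.IsQF θ ∧
      ∀ (M : Type w) [L.Structure M], M ⊨ eliminationTheory τ → ∀ a : α → M,
        φ.Realize a ↔ θ.Realize a := by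
  obtain ⟨n, g, φ', hφ'⟩ := φ.exists_fin_relabel
  obtain ⟨θ, hθ, h⟩ :=
    exists_isQF_iff_bounded.{u, v, w} hτ (BoundedFormula.relabel (n := n) (Sum.inr : _ → Empty ⊕ Fin n) φ')
  refine ⟨θ.relabel g, hθ.formula_relabel g, fun M _ hM a => ?_⟩
  rw [hφ', Formula.realize_relabel, ← h M hM]
  exact (Formula.realize_relabel_sumInr φ').symm

end Elimination

/-! ### Unions of chains and universal sentences -/

section Chain

/-- The union of a chain of structures. -/
theorem exists_directLimit {G : ℕ → Type w} [∀ n, L.Structure (G n)]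
    (f : ∀ n, G n ↪[L] G (n + 1)) :
    ∃ (D : Type w) (_ : L.Structure D) (g : ∀ n, G n ↪[L] D),
      (∀ n x, g (n + 1) (f n x) = g n x) ∧
      ∀ (m : ℕ) (a : Fin m → D), ∃ (i : ℕ) (b : Fin m → G i), a = g i ∘ b := by
  refine ⟨DirectLimit G (DirectedSystem.natLERec f), inferInstance,
    DirectLimit.of L ℕ G (DirectedSystem.natLERec f), fun n x => ?_, fun m a => ?_⟩
  · have : f n x = DirectedSystem.natLERec f n (n + 1) n.le_succ x := by
      rw [DirectedSystem.coe_natLERec]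
      exact (Nat.leRecOn_succ' (C := G) (next := fun {k} => f k) x).symm
    rw [this, DirectLimit.of_f]
  · obtain ⟨i, b, hb⟩ := DirectLimit.exists_quotient_mk'_sigma_mk'_eq G
      (DirectedSystem.natLERec f) a
    exact ⟨i, b, hb⟩

/-- A finite tuple of `D` comes from a single stage, and the embedding of that stage preserves
quantifier-free formulas. -/
theorem BoundedFormula.IsUniversal.realize_of_forall {G : ℕ → Type*} [∀ n, L.Structure (G n)]
    {D : Type*} [L.Structure D] (g : ∀ n, G n ↪[L] D)
    (hg : ∀ (m : ℕ) (a : Fin m → D), ∃ (i : ℕ) (b : Fin m → G i), a = g i ∘ b)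
    {m : ℕ} {φ : L.BoundedFormula Empty m} (hφ : φ.IsUniversal)
    (h : ∀ i (b : Fin m → G i), φ.Realize default b) (a : Fin m → D) : φ.Realize default a := by
  induction hφ with
  | of_isQF hφ =>
    obtain ⟨i, b, rfl⟩ := hg _ a
    rw [← Subsingleton.elim (g i ∘ default) default]
    exact (hφ.realize_embedding (g i)).2 (h i b)
  | all _ ih =>
    refine BoundedFormula.realize_all.2 fun x => ih (fun i b => ?_) _
    have := BoundedFormula.realize_all.1 (h i (Fin.init b)) (b (Fin.last _))
    rwa [Fin.snoc_init_self] at this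

end Chain

/-! ### Construction of the model completion -/

section Completion

variable {K : Set (CategoryTheory.Bundled.{max u v w} L.Structure)}

theorem IsUniversalClass.directLimit_mem (hK : IsUniversalClass K)
    {G : ℕ → CategoryTheory.Bundled.{max u v w} L.Structure} (hG : ∀ n, G n ∈ K)
    {D : CategoryTheory.Bundled.{max u v w} L.Structure} (g : ∀ n, G n ↪[L] D)
    (hg : ∀ (m : ℕ) (a : Fin m → D), ∃ (i : ℕ) (b : Fin m → G i), a = g i ∘ b) : D ∈ K := by
  obtain ⟨U, hU', hU⟩ := hK
  refine (hU D).2 ((Theory.model_iff _).2 fun φ hφ => ?_)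
  refine (hU'.isUniversal_of_mem hφ).realize_of_forall g hg (fun i b => ?_) default
  have := (Theory.model_iff _).1 ((hU (G i)).1 (hG i)) φ hφ
  rwa [Subsingleton.elim b default]

/-- The formula `τ` holds of exactly those tuples that can be extended to a realization of `ψ` in
some extension that belongs to `K`. -/
def DefinesExtendability (K : Set (CategoryTheory.Bundled.{w} L.Structure)) {n : ℕ}
    (ψ : L.Formula (Fin n ⊕ Unit)) (τ : L.Formula (Fin n)) : Prop :=
  ∀ A ∈ K, ∀ a : Fin n → A,
    τ.Realize a ↔ ∃ B ∈ K, ∃ (f : A ↪[L] B) (b : B), ψ.Realize (Sum.elim (f ∘ a) fun _ => b)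

theorem realize_sumElim_comp {M N : Type*} [L.Structure M] [L.Structure N] {α : Type*}
    {φ : L.Formula (α ⊕ Unit)} (hφ : BoundedFormula.IsQF φ) (f : M ↪[L] N) {a : α → M} {b : M} :
    φ.Realize (Sum.elim (f ∘ a) fun _ => f b) ↔ φ.Realize (Sum.elim a fun _ => b) := by
  rw [← hφ.realize_comp_embedding f, Sum.comp_elim]
  rfl

theorem realize_conjEqns {α : Type*} {M : Type*} [L.Structure M]
    {l : List (L.Term α × L.Term α)} {a : α → M} :
    (conjEqns l).Realize a ↔ ∀ e ∈ l, (eqnFormula e).Realize a := by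
  simp only [conjEqns, realize_conj, List.forall_mem_map]

theorem realize_conjPos_of_conjLiterals {α : Type*} {M : Type*} [L.Structure M]
    {ψ : List (Literal L α)} {a : α → M} (h : (conjLiterals ψ).Realize a) :
    (conjPos ψ).Realize a := by
  refine realize_conjEqns.2 fun e he => ?_
  obtain ⟨l, hl, hle⟩ := List.mem_filterMap.1 he
  cases l with
  | pos e' =>
    obtain rfl : e' = e := Option.some.inj hle
    exact realize_conjLiterals.1 h _ hl
  | neg e' => cases hle

/-- This is where the three properties combine; they enter the construction of the model completion
only through this lemma. -/
theorem exists_definesExtendability (hK : IsUniversalClass K) (hA : Amalgamation K)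
    (hV : VariableProjectionProperty K) (hC : ConservativeModelExtensionProperty K) (n : ℕ)
    (ψ : List (Literal L (Fin n ⊕ Unit))) :
    ∃ τ : L.Formula (Fin n), BoundedFormula.IsQF τ ∧
      DefinesExtendability K (conjLiterals ψ) τ := by
  obtain ⟨ξ, hξ, hξ₁, hξ₂⟩ := hV n (ψ.filterMap Literal.posPart)
  obtain ⟨χ, hχ, hχ₁, hχ₂⟩ := hC n ψ
  refine ⟨χ ⊓ ξ, hχ.inf hξ, fun A hAK a => ⟨fun h => ?_, ?_⟩⟩
  · rw [Formula.realize_inf] at h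
    let S : CategoryTheory.Bundled.{max u v w} L.Structure :=
      .of (Substructure.closure L (Set.range a))
    let i : S ↪[L] A := Substructure.subtype _
    have hS : S ∈ K := hK.mem_of_embedding hAK i
    let c : Fin n → S := closureTuple a
    have hχc : χ.Realize c := (hχ.realize_comp_embedding i).1 h.1
    have hξc : ξ.Realize c := (hξ.realize_comp_embedding i).1 h.2
    -- `ξ` implies every equation in x̄ that follows from `ψ⁺`, as condition (ii) demands.
    obtain ⟨B, hB, f, b, hb⟩ := hχ₂ S hS c (closure_range_closureTuple a) hχc fun ε hε =>
      Formula.realize_imp.1 (hξ₂ ε hε S hS c) hξc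
    -- `B` extends only the subalgebra generated by `a`; amalgamating over it gives an extension of
    -- `A`.
    obtain ⟨D, g, k, hD, hgk⟩ := hA S A B i f hS hAK hB
    refine ⟨D, hD, g, k b, ?_⟩
    have hac : g ∘ a = k ∘ f ∘ c := funext fun x =>
      congrArg (fun e : S ↪[L] D => e (c x)) hgk
    rw [hac]
    exact (realize_sumElim_comp (isQF_conjLiterals ψ) k).2 hb
  · rintro ⟨B, hB, f, b, hb⟩
    rw [← (hχ.inf hξ).realize_comp_embedding f, Formula.realize_inf]
    refine ⟨?_, ?_⟩
    · exact realize_relabel_inl_elim.1 (Formula.realize_imp.1 (hχ₁ B hB _) hb)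
    · exact realize_relabel_inl_elim.1
        (Formula.realize_imp.1 (hξ₁ B hB _) (realize_conjPos_of_conjLiterals hb))

variable {τ : ∀ n : ℕ, List (Literal L (Fin n ⊕ Unit)) → L.Formula (Fin n)}

/-- An extension of `A` realizing finitely many extendable conjunctions of literals. -/
theorem exists_extension_of_finset (hτ : ∀ n ψ, BoundedFormula.IsQF (τ n ψ))
    (h : ∀ n ψ, DefinesExtendability K (conjLiterals ψ) (τ n ψ))
    {A : CategoryTheory.Bundled.{max u v w} L.Structure} (hA : A ∈ K)
    (s : Finset {p : Σ n : ℕ, List (Literal L (Fin n ⊕ Unit)) × (Fin n → A) //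
      (τ p.1 p.2.1).Realize p.2.2}) :
    ∃ B ∈ K, ∃ (f : A ↪[L] B), ∀ p ∈ s, ∃ b : B,
      (conjLiterals p.1.2.1).Realize (Sum.elim (f ∘ p.1.2.2) fun _ => b) := by
  classical
  induction s using Finset.induction_on with
  | empty => exact ⟨A, hA, Embedding.refl L A, by simp⟩
  | insert p s _ ih =>
    obtain ⟨B, hB, f, hf⟩ := ih
    -- The next requirement persists from `A` to `B` because `τ` is quantifier-free; earlier
    -- witnesses persist from `B` to `D`.
    obtain ⟨D, hD, g, b, hb⟩ := (h _ p.1.2.1 B hB (f ∘ p.1.2.2)).1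
      (((hτ _ _).realize_comp_embedding f).2 p.2)
    refine ⟨D, hD, g.comp f, fun q hq => ?_⟩
    obtain rfl | hq := Finset.mem_insert.1 hq
    · exact ⟨b, hb⟩
    · obtain ⟨c, hc⟩ := hf q hq
      exact ⟨g c, (realize_sumElim_comp (isQF_conjLiterals _) g).2 hc⟩

variable [L.IsAlgebraic] [Nonempty L.Constants]

/-- An extension of `A` realizing all extendable conjunctions of literals with parameters
from `A`. -/
theorem exists_extension (hK : IsUniversalClass K) (hτ : ∀ n ψ, BoundedFormula.IsQF (τ n ψ))
    (h : ∀ n ψ, DefinesExtendability K (conjLiterals ψ) (τ n ψ))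
    {A : CategoryTheory.Bundled.{max u v w} L.Structure} (hA : A ∈ K) :
    ∃ B ∈ K, ∃ (f : A ↪[L] B),
      ∀ (n : ℕ) (ψ : List (Literal L (Fin n ⊕ Unit))) (a : Fin n → A), (τ n ψ).Realize a →
        ∃ b : B, (conjLiterals ψ).Realize (Sum.elim (f ∘ a) fun _ => b) := by
  classical
  let I := {p : Σ n : ℕ, List (Literal L (Fin n ⊕ Unit)) × (Fin n → A) //
    (τ p.1 p.2.1).Realize p.2.2}
  -- Each requirement gets its own new variable for its witness.
  let Φ : {φ : L.Formula A // BoundedFormula.IsQF φ ∧ φ.Realize id} ⊕ I → L.Formula (A ⊕ I) :=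
    Sum.elim (fun φ => φ.1.relabel Sum.inl)
      fun p => (conjLiterals p.1.2.1).relabel (Sum.elim (Sum.inl ∘ p.1.2.2) fun _ => Sum.inr p)
  obtain ⟨M, a, ha⟩ := Theory.exists_realize_forall_of_finset.{u, v, max u v w, max u v w, w}
    (T := classTheory K) Φ (by
      intro s
      obtain ⟨B, hB, f, hf⟩ := exists_extension_of_finset hτ h hA s.toRight
      have : Nonempty B := nonempty_of_nonempty_constants L B
      have := (hK.mem_iff B).1 hB
      choose! c hc using hf
      refine ⟨.of _ B, Sum.elim f c, ?_⟩
      rintro (φ | p) hs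
      · exact Formula.realize_relabel.2 ((φ.2.1.realize_comp_embedding f (a := id)).2 φ.2.2)
      · refine Formula.realize_relabel.2 ?_
        rw [Sum.comp_elim]
        exact hc p (Finset.mem_toRight.2 hs))
  obtain ⟨f, hf⟩ := exists_embedding_of_qf (a ∘ Sum.inl) fun φ h1 h2 =>
    Formula.realize_relabel.1 (ha (.inl ⟨φ, h1, h2⟩))
  refine ⟨.of M, (hK.mem_iff _).2 M.is_model, f, fun n ψ x hx => ⟨a (.inr ⟨⟨n, ψ, x⟩, hx⟩), ?_⟩⟩
  have := Formula.realize_relabel.1 (ha (.inr ⟨⟨n, ψ, x⟩, hx⟩))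
  rw [Sum.comp_elim, ← Function.comp_assoc, ← hf] at this
  exact this

/-- Every member of `K` embeds into a member of `K` that is a model of the elimination theory. -/
theorem exists_embedding_model_eliminationTheory (hK : IsUniversalClass K)
    (hτ : ∀ n ψ, BoundedFormula.IsQF (τ n ψ))
    (h : ∀ n ψ, DefinesExtendability K (conjLiterals ψ) (τ n ψ))
    {A : CategoryTheory.Bundled.{max u v w} L.Structure} (hA : A ∈ K) :
    ∃ D ∈ K, Nonempty (A ↪[L] D) ∧ D ⊨ eliminationTheory τ := by
  choose B hB f hf using fun A : K => exists_extension hK hτ h A.2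
  -- Each stage solves all requirements with parameters in the previous one, so in the union every
  -- tuple finds its witness one stage later.
  let G : ℕ → K := fun n => Nat.rec ⟨A, hA⟩ (fun _ X => ⟨B X, hB X⟩) n
  obtain ⟨D, hDs, g, hgf, hg⟩ := exists_directLimit (L := L) (G := fun n => (G n).1) fun n => f (G n)
  have hD : CategoryTheory.Bundled.of (c := L.Structure) D ∈ K :=
    hK.directLimit_mem (fun n => (G n).2) g hg
  refine ⟨.of D, hD, ⟨g 0⟩, model_eliminationTheory_iff.2 fun n ψ a => ⟨fun ha => ?_, ?_⟩⟩
  · obtain ⟨i, x, rfl⟩ := hg n a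
    obtain ⟨b, hb⟩ := hf (G i) n ψ x (((hτ n ψ).realize_comp_embedding (g i)).1 ha)
    refine ⟨g (i + 1) b, ?_⟩
    have hx : g i ∘ x = g (i + 1) ∘ f (G i) ∘ x := funext fun j => (hgf i (x j)).symm
    rw [hx]
    exact (realize_sumElim_comp (isQF_conjLiterals ψ) (g (i + 1))).2 hb
  -- The union is itself in `K`, so it counts as its own extension.
  · rintro ⟨b, hb⟩
    exact (h n ψ _ hD a).2 ⟨_, hD, Embedding.refl L D, b, hb⟩

theorem isModelCompletion_union_eliminationTheory (hK : IsUniversalClass K)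
    (hτ : ∀ n ψ, BoundedFormula.IsQF (τ n ψ))
    (h : ∀ n ψ, DefinesExtendability K (conjLiterals ψ) (τ n ψ)) :
    Theory.IsModelCompletion.{u, v, w} (classTheory K ∪ eliminationTheory τ) (classTheory K) := by
  have hE : ∀ A ∈ K, ∃ D : (classTheory K ∪ eliminationTheory τ).ModelType.{u, v, max u v w},
      Nonempty (A ↪[L] D) := fun A hA => by
    obtain ⟨D, hD, hAD, hDτ⟩ := exists_embedding_model_eliminationTheory hK hτ h hA
    have : Nonempty D := nonempty_of_nonempty_constants L D
    have := ((hK.mem_iff D).1 hD).union hDτ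
    exact ⟨.of _ D, hAD⟩
  refine ⟨⟨fun n φ => ?_, fun φ hφ => ⟨fun hT => ?_, fun hT => ?_⟩⟩, fun A _ _ hA => ?_⟩
  · obtain ⟨θ, hθ, hφθ⟩ := exists_isQF_iff_of_model_eliminationTheory.{u, v, max u v} hτ φ
    refine ⟨θ, hθ.isExistential, Theory.models_formula_iff.2 fun M a => ?_⟩
    exact Formula.realize_iff.2 (hφθ M (M.is_model.mono Set.subset_union_right) a)
  · exact Theory.models_of_models_theory
      (fun σ hσ => Theory.models_sentence_of_mem (Or.inl hσ)) hT
  -- Universal sentences pass down from a model of the larger theory to the members of `K` inside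
  -- it.
  · refine Theory.models_sentence_of_mem fun A hA => ?_
    obtain ⟨D, ⟨f⟩⟩ := hE A hA
    refine hφ.realize_embedding f ?_
    rw [Subsingleton.elim (f ∘ default) default, Subsingleton.elim (f ∘ default) default]
    exact hT.realize_sentence D
  · have hAK : CategoryTheory.Bundled.of (c := L.Structure) A ∈ K := (hK.mem_iff _).2 hA
    refine ⟨?_, fun φ => ?_⟩
    · obtain ⟨D, ⟨f⟩⟩ := hE _ hAK
      let : (constantsOn A).Structure D := constantsOn.structure f
      have h1 : D ⊨ (L.lhomWithConstants A).onTheory (classTheory K ∪ eliminationTheory τ) :=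
        (LHom.onTheory_model _ _).2 inferInstance
      have h2 : D ⊨ L.diagram A := Embedding.model_diagram f
      have := h1.union h2
      exact Theory.Model.isSatisfiable D
    · obtain ⟨θ, hθ, hφθ⟩ := exists_isQF_iff_of_model_eliminationTheory.{u, v, max u v w} hτ
        (Formula.equivSentence.symm φ)
      -- Every model extends `A`, so the truth of `φ` is settled by whether `θ` holds in `A` itself.
      have key : ∀ N : ((L.lhomWithConstants A).onTheory (classTheory K ∪ eliminationTheory τ) ∪
          L.diagram A).ModelType.{max u v w, v, max u v w}, N ⊨ φ ↔ θ.Realize (id : A → A) := by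
        intro N
        have hN := N.is_model
        rw [Theory.model_union_iff] at hN
        let := (L.lhomWithConstants A).reduct N
        have hNT := (LHom.onTheory_model (L.lhomWithConstants A) _).1 hN.1
        obtain ⟨f, hf⟩ := exists_embedding_of_model_diagram (M := A) (N := N) hN.2
        rw [← Formula.realize_equivSentence_symm_con N,
          hφθ N (hNT.mono Set.subset_union_right), ← hθ.realize_comp_embedding f, ← funext hf]
        rfl
      by_cases hA' : θ.Realize (id : A → A)
      · exact Or.inl (Theory.models_sentence_iff.2 fun N => (key N).2 hA')
      · exact Or.inr (Theory.models_sentence_iff.2 fun N hN => hA' ((key N).1 hN))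

end Completion

end FirstOrder.Language

theorem theorem3p2 {L : FirstOrder.Language.{u, v}} [L.IsAlgebraic] [Nonempty L.Constants]
    (K : Set (CategoryTheory.Bundled.{max u v w} L.Structure))
    (hK : FirstOrder.Language.IsUniversalClass K) :
    (∃ T : L.Theory,
      FirstOrder.Language.Theory.IsModelCompletion.{u, v, w} T
        (FirstOrder.Language.classTheory K)) ↔
      FirstOrder.Language.Amalgamation K ∧
      FirstOrder.Language.VariableProjectionProperty K ∧
      FirstOrder.Language.ConservativeModelExtensionProperty K := by
  constructor
  · rintro ⟨T, hT⟩
    exact ⟨hT.amalgamation hK, hT.variableProjectionProperty hK,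
      hT.conservativeModelExtensionProperty hK⟩
  · rintro ⟨hA, hV, hC⟩
    choose τ hτ h using FirstOrder.Language.exists_definesExtendability hK hA hV hC
    exact ⟨_, FirstOrder.Language.isModelCompletion_union_eliminationTheory hK hτ h⟩
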